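/- Let $d\ge 1$, $\mathbb R^d_+=(0,\infty)^d$ with the Euclidean norm $\|\cdot\|$, $e=(d^{-1/2},\dots,d^{-1/2})$, and $S_+=\{x\in\mathbb R^d_+:\|x\|=1\}$. "Measurable" means Borel measurable. A measurable function $f:\mathbb R^d_+\to(0,\infty)$ is called radially regularly varying if for every $x\in\mathbb R^d_+$ the limit $\lim_{t\to\infty} f(tx)/f(te)=\varphi(x)$ exists and $\varphi(x)\in(0,\infty)$. A measurable function $L:\mathbb R^d_+\to[0,\infty)$ is called radially slowly varying if there is a function $\lambda:S_+\to[0,\infty)$ with $\lambda(e)=1$ such that, for every $x\in\mathbb R^d_+$, $\lim_{t\to\infty}L(tx)/L(te)=\lambda(x/\|x\|)$, and $L(x)=0$ if and only if $\lambda(x/\|x\|)=0$. (For positive $L$ the last condition says that $\lambda$ is positive.) A measurable function $l:(0,\infty)\to(0,\infty)$ is called slowly varying if $\lim_{t\to\infty}l(ct)/l(t)=1$ for every $c>0$. (1) If $f:\mathbb R^d_+\to(0,\infty)$ is radially regularly varying, then there are $\rho\in\mathbb R$ and a radially slowly varying $L$ such that $f(x)=\|x\|^{\rho}L(x)$ for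 all $x\in\mathbb R^d_+$. (2) A measurable function $L:\mathbb R^d_+\to\mathbb R$ is radially slowly varying if and only if $$L(x)=K(x)\,l(\|x\|)\,\lambda(x/\|x\|),\qquad x\in\mathbb R^d_+,$$ for some slowly varying $l:(0,\infty)\to(0,\infty)$, some $\lambda:S_+\to[0,\infty)$ with $\lambda(e)>0$, and some positive function $K$ of the form $$K(x)=\exp\Big(\eta(x)+\int_a^{\|x\|}\frac{\varepsilon(u)}{u}\,du\Big),\qquad x\in\mathbb R^d_+,$$ where $a>0$; $\eta:\mathbb R^d_+\to\mathbb R$ is a function for which there is a constant $C\in\mathbb R$ with $\lim_{t\to\infty}\eta(tx)=C$ for every $x\in\mathbb R^d_+$; and $\varepsilon$ is a real function on $(0,\infty)$, with $\varepsilon(u)/u$ integrable on every compact subinterval of $(0,\infty)$, such that $\varepsilon(t)=o(t^{-k})$ as $t\to\infty$ for every $k\ge 0$. -/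

import Mathlib

open Filter Topology MeasureTheory Asymptotics

noncomputable section

namespace RadialVariation

/-- The open orthant `(0, ∞)^d` in Euclidean space. -/
def orthant (d : ℕ) : Set (EuclideanSpace ℝ (Fin d)) := {x | ∀ i, 0 < x i}

/-- The reference direction `e = (d^{-1/2}, …, d^{-1/2})`. -/
def diagDir (d : ℕ) : EuclideanSpace ℝ (Fin d) :=
  WithLp.toLp 2 fun _ => (Real.sqrt (d : ℝ))⁻¹

/-- The direction `x / ‖x‖` of a vector. -/
def dir {d : ℕ} (x : EuclideanSpace ℝ (Fin d)) : EuclideanSpace ℝ (Fin d) := ‖x‖⁻¹ • x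

/-- The part of the unit sphere that lies in the open orthant. -/
def spherePart (d : ℕ) : Set (EuclideanSpace ℝ (Fin d)) := {a | a ∈ orthant d ∧ ‖a‖ = 1}

/-- Radially regularly varying functions `(0, ∞)^d → (0, ∞)`. Only the values of `f` on the
orthant matter. -/
def IsRadiallyRegularlyVarying {d : ℕ} (f : EuclideanSpace ℝ (Fin d) → ℝ) : Prop :=
  Measurable ((orthant d).domRestrict f) ∧
  (∀ x ∈ orthant d, 0 < f x) ∧
  ∃ φ : EuclideanSpace ℝ (Fin d) → ℝ, ∀ x ∈ orthant d,
    0 < φ x ∧ Tendsto (fun t : ℝ => f (t • x) / f (t • diagDir d)) atTop (𝓝 (φ x))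

/-- The defining relation of radial slow variation with limit function `lam`: `lam` is non-negative
on the part of the unit sphere in the orthant, `lam e = 1`, and
`L (t x) / L (t e) → lam (x / ‖x‖)` as `t → ∞`, for every `x` in the orthant. -/
def IsRadialLimit {d : ℕ} (L lam : EuclideanSpace ℝ (Fin d) → ℝ) : Prop :=
  (∀ a ∈ spherePart d, 0 ≤ lam a) ∧
  lam (diagDir d) = 1 ∧
  ∀ x ∈ orthant d,
    Tendsto (fun t : ℝ => L (t • x) / L (t • diagDir d)) atTop (𝓝 (lam (dir x)))

/-- Radially slowly varying functions `(0, ∞)^d → [0, ∞)`. The last clause says that `L` vanishes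
exactly on the rays on which the limit function vanishes; for a positive `L` it says that the limit
function is positive. -/
def IsRadiallySlowlyVarying {d : ℕ} (L : EuclideanSpace ℝ (Fin d) → ℝ) : Prop :=
  Measurable ((orthant d).domRestrict L) ∧
  (∀ x ∈ orthant d, 0 ≤ L x) ∧
  ∃ lam : EuclideanSpace ℝ (Fin d) → ℝ, IsRadialLimit L lam ∧
    ∀ x ∈ orthant d, (L x = 0 ↔ lam (dir x) = 0)

/-- Univariate (Karamata) slowly varying functions `(0, ∞) → (0, ∞)`. -/
def IsSlowlyVarying (l : ℝ → ℝ) : Prop :=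
  Measurable ((Set.Ioi (0 : ℝ)).domRestrict l) ∧
  (∀ t : ℝ, 0 < t → 0 < l t) ∧
  ∀ c : ℝ, 0 < c → Tendsto (fun t : ℝ => l (c * t) / l t) atTop (𝓝 1)

/-- The representation `K x = exp (η x + ∫_a^{‖x‖} ε(u)/u du)` on the orthant, where `a > 0`,
`η` tends to one real constant `C` along every ray, and `ε(t) = o(t^{-k})` as `t → ∞` for every
`k ≥ 0`. -/
def HasExpIntegralRep {d : ℕ} (K : EuclideanSpace ℝ (Fin d) → ℝ) : Prop :=
  ∃ (a C : ℝ) (η : EuclideanSpace ℝ (Fin d) → ℝ) (ε : ℝ → ℝ),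
    0 < a ∧
    (∀ x ∈ orthant d, Tendsto (fun t : ℝ => η (t • x)) atTop (𝓝 C)) ∧
    (∀ k : ℝ, 0 ≤ k → ε =o[atTop] fun t : ℝ => t ^ (-k)) ∧
    (∀ b : ℝ, 0 < b → IntervalIntegrable (fun u => ε u / u) volume a b) ∧
    ∀ x ∈ orthant d, K x = Real.exp (η x + ∫ u in a..‖x‖, ε u / u)

end RadialVariation

end

namespace RadialVariation

variable {d : ℕ}

/-! Regular variation: inserting `f (tc • e)` between numerator and denominator gives `φ (c • x) = φ
x * φ (c • e)` (`limit_smul`). So `c ↦ φ (c • e)` is multiplicative, and measurable as a pointwise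
limit, hence a power `c ^ ρ`; dividing `f` by `‖x‖ ^ ρ` leaves a limit that depends on the direction
only.

Representation: compare `x` with the diagonal point of the same norm. With `l t = L (t • e)`, the
quotient `L x / (l ‖x‖ * lam (dir x))` tends to `1` along each ray where `lam` is nonzero, so its
logarithm serves as `η` and `ε = 0` suffices. Conversely, `K` and `l` contribute ratios tending to
`1`, because `ε → 0` makes the integral of `ε(u)/u` between `t` and `t‖x‖` vanish in the limit. -/

lemma smul_mem_orthant {x : EuclideanSpace ℝ (Fin d)} (hx : x ∈ orthant d) {t : ℝ} (ht : 0 < t) :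
    t • x ∈ orthant d := fun i => by
  simpa using mul_pos ht (hx i)

lemma norm_pos_of_mem_orthant (hd : 1 ≤ d) {x : EuclideanSpace ℝ (Fin d)} (hx : x ∈ orthant d) :
    0 < ‖x‖ := by
  rw [norm_pos_iff]
  rintro rfl
  simpa using hx ⟨0, hd⟩

lemma diagDir_mem_orthant (hd : 1 ≤ d) : diagDir d ∈ orthant d := fun i => by
  have : (0 : ℝ) < d := by exact_mod_cast hd
  simpa [diagDir] using this

lemma norm_diagDir (hd : 1 ≤ d) : ‖diagDir d‖ = 1 := by
  have : (0 : ℝ) < d := by exact_mod_cast hd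
  rw [EuclideanSpace.norm_eq]
  simp [diagDir, this.ne']

lemma norm_smul_diagDir (hd : 1 ≤ d) {t : ℝ} (ht : 0 < t) : ‖t • diagDir d‖ = t := by
  rw [norm_smul, norm_diagDir hd, mul_one, Real.norm_of_nonneg ht.le]

lemma dir_smul (x : EuclideanSpace ℝ (Fin d)) {t : ℝ} (ht : 0 < t) : dir (t • x) = dir x := by
  rw [dir, dir, norm_smul, Real.norm_of_nonneg ht.le, smul_smul]
  congr 1
  field_simp

lemma dir_diagDir (hd : 1 ≤ d) : dir (diagDir d) = diagDir d := by
  simp [dir, norm_diagDir hd]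

lemma dir_mem_spherePart (hd : 1 ≤ d) {x : EuclideanSpace ℝ (Fin d)} (hx : x ∈ orthant d) :
    dir x ∈ spherePart d := by
  have hn := norm_pos_of_mem_orthant hd hx
  refine ⟨smul_mem_orthant hx (inv_pos.2 hn), ?_⟩
  rw [dir, norm_smul, norm_inv, norm_norm, inv_mul_cancel₀ hn.ne']

lemma norm_smul_dir (hd : 1 ≤ d) {x : EuclideanSpace ℝ (Fin d)} (hx : x ∈ orthant d) :
    ‖x‖ • dir x = x := by
  rw [dir, smul_inv_smul₀ (norm_pos_of_mem_orthant hd hx).ne']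

/-- The restriction of a measurable function on the orthant to an open ray is measurable. -/
lemma measurable_comp_smul {f : EuclideanSpace ℝ (Fin d) → ℝ}
    (hf : Measurable ((orthant d).domRestrict f)) {x : EuclideanSpace ℝ (Fin d)}
    (hx : x ∈ orthant d) :
    Measurable (fun t : Set.Ioi (0 : ℝ) => f ((t : ℝ) • x)) := by
  have h : Measurable (fun t : Set.Ioi (0 : ℝ) =>
      (⟨(t : ℝ) • x, smul_mem_orthant hx t.2⟩ : orthant d)) :=
    (measurable_subtype_coe.smul_const x).subtype_mk
  exact hf.comp h

/-! ### The index of regular variation -/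

/-- A measurable positive function on `(0, ∞)` that is multiplicative is a power function. -/
lemma exists_rpow_of_measurable_of_mul {g : ℝ → ℝ}
    (hg : Measurable (fun t : Set.Ioi (0 : ℝ) => g t)) (hpos : ∀ t, 0 < t → 0 < g t)
    (hmul : ∀ s t, 0 < s → 0 < t → g (s * t) = g s * g t) :
    ∃ ρ : ℝ, ∀ t, 0 < t → g t = t ^ ρ := by
  -- In logarithmic coordinates `g` becomes additive; measurability makes it continuous, hence
  -- linear with slope `F 1`.
  let F : ℝ →+ ℝ := AddMonoidHom.mk' (fun u => Real.log (g (Real.exp u))) fun u v => by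
    rw [Real.exp_add, hmul _ _ (Real.exp_pos u) (Real.exp_pos v),
      Real.log_mul (hpos _ (Real.exp_pos u)).ne' (hpos _ (Real.exp_pos v)).ne']
  have hF : Measurable F := by
    have h : Measurable (fun u : ℝ => (⟨Real.exp u, Real.exp_pos u⟩ : Set.Ioi (0 : ℝ))) :=
      Real.measurable_exp.subtype_mk
    exact Real.measurable_log.comp (hg.comp h)
  have hcont : Continuous F := MeasureTheory.Measure.AddMonoidHom.continuous_of_measurable F hF
  refine ⟨F 1, fun t ht => ?_⟩
  have h := map_real_smul F hcont (Real.log t) 1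
  rw [smul_eq_mul, mul_one, smul_eq_mul] at h
  have h' : F (Real.log t) = Real.log (g t) := by
    change Real.log (g (Real.exp (Real.log t))) = _
    rw [Real.exp_log ht]
  rw [h'] at h
  rw [Real.rpow_def_of_pos ht, ← h, Real.exp_log (hpos t ht)]

/-- The limit function of a radially regularly varying function scales along every ray as it does
along the diagonal. -/
lemma limit_smul (hd : 1 ≤ d) {f φ : EuclideanSpace ℝ (Fin d) → ℝ}
    (hpos : ∀ x ∈ orthant d, 0 < f x)
    (hφ : ∀ x ∈ orthant d,
      Tendsto (fun t : ℝ => f (t • x) / f (t • diagDir d)) atTop (𝓝 (φ x)))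
    {x : EuclideanSpace ℝ (Fin d)} (hx : x ∈ orthant d) {c : ℝ} (hc : 0 < c) :
    φ (c • x) = φ x * φ (c • diagDir d) := by
  have he := diagDir_mem_orthant hd
  have h₁ : Tendsto (fun t : ℝ => f ((t * c) • x) / f ((t * c) • diagDir d)) atTop (𝓝 (φ x)) :=
    (hφ x hx).comp (tendsto_id.atTop_mul_const hc)
  have h₂ := h₁.mul (hφ _ (smul_mem_orthant he hc))
  refine tendsto_nhds_unique (hφ _ (smul_mem_orthant hx hc)) (h₂.congr' ?_)
  filter_upwards [eventually_gt_atTop 0] with t ht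
  have := (hpos _ (smul_mem_orthant he (mul_pos ht hc))).ne'
  rw [smul_smul, smul_smul, div_mul_div_cancel₀ this]

/-- The limit function of a radially regularly varying function is a power along the diagonal. -/
lemma exists_index (hd : 1 ≤ d) {f φ : EuclideanSpace ℝ (Fin d) → ℝ}
    (hf : Measurable ((orthant d).domRestrict f)) (hpos : ∀ x ∈ orthant d, 0 < f x)
    (hφpos : ∀ x ∈ orthant d, 0 < φ x)
    (hφ : ∀ x ∈ orthant d,
      Tendsto (fun t : ℝ => f (t • x) / f (t • diagDir d)) atTop (𝓝 (φ x))) :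
    ∃ ρ : ℝ, ∀ c, 0 < c → φ (c • diagDir d) = c ^ ρ := by
  have he := diagDir_mem_orthant hd
  refine exists_rpow_of_measurable_of_mul (g := fun c => φ (c • diagDir d)) ?_
    (fun t ht => hφpos _ (smul_mem_orthant he ht)) fun s t hs ht => ?_
  -- A sequence of scales suffices; the shift `n + 1` keeps every scale positive.
  · refine measurable_of_tendsto_metrizable (f := fun (n : ℕ) (c : Set.Ioi (0 : ℝ)) =>
      f (((n : ℝ) + 1) • (c : ℝ) • diagDir d) / f (((n : ℝ) + 1) • diagDir d)) (fun n => ?_) ?_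
    · have hn : (0 : ℝ) < n + 1 := by positivity
      have h := measurable_comp_smul hf (smul_mem_orthant he hn)
      simp only [smul_comm ((n : ℝ) + 1)]
      exact h.div_const _
    · rw [tendsto_pi_nhds]
      intro c
      have hn : Tendsto (fun n : ℕ => (n : ℝ) + 1) atTop atTop :=
        tendsto_atTop_add_const_right _ _ tendsto_natCast_atTop_atTop
      exact (hφ _ (smul_mem_orthant he c.2)).comp hn
  · rw [mul_smul, limit_smul hd hpos hφ (smul_mem_orthant he ht) hs, mul_comm]

/-- A radially regularly varying function is a power of the norm times a radially slowly varying
function. -/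
theorem IsRadiallyRegularlyVarying.exists_rpow_mul (hd : 1 ≤ d)
    {f : EuclideanSpace ℝ (Fin d) → ℝ} (h : IsRadiallyRegularlyVarying f) :
    ∃ (ρ : ℝ) (L : EuclideanSpace ℝ (Fin d) → ℝ), IsRadiallySlowlyVarying L ∧
      ∀ x ∈ orthant d, f x = ‖x‖ ^ ρ * L x := by
  obtain ⟨hf, hpos, φ, hφ'⟩ := h
  have hφpos := fun x hx => (hφ' x hx).1
  have hφ := fun x hx => (hφ' x hx).2
  have he := diagDir_mem_orthant hd
  obtain ⟨ρ, hρ⟩ := exists_index hd hf hpos hφpos hφ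
  have hφdir : ∀ x ∈ orthant d, φ x = φ (dir x) * ‖x‖ ^ ρ := fun x hx => by
    have hn := norm_pos_of_mem_orthant hd hx
    rw [← hρ _ hn, ← limit_smul hd hpos hφ (dir_mem_spherePart hd hx).1 hn, norm_smul_dir hd hx]
  have hLpos : ∀ x ∈ orthant d, 0 < f x / ‖x‖ ^ ρ := fun x hx =>
    div_pos (hpos x hx) (Real.rpow_pos_of_pos (norm_pos_of_mem_orthant hd hx) ρ)
  refine ⟨ρ, fun x => f x / ‖x‖ ^ ρ, ⟨?_, fun x hx => (hLpos x hx).le, φ,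
    ⟨fun a ha => (hφpos a ha.1).le, ?_, fun x hx => ?_⟩, fun x hx => ?_⟩, fun x hx => ?_⟩
  · exact hf.div (measurable_subtype_coe.norm.pow_const ρ)
  · simpa using hρ 1 one_pos
  · have hn := norm_pos_of_mem_orthant hd hx
    have hnρ := (Real.rpow_pos_of_pos hn ρ).ne'
    have h := (hφ x hx).div_const (‖x‖ ^ ρ)
    rw [hφdir x hx, mul_div_cancel_right₀ _ hnρ] at h
    refine h.congr' ?_
    filter_upwards [eventually_gt_atTop 0] with t ht
    have htρ := (Real.rpow_pos_of_pos ht ρ).ne'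
    have hfe := (hpos _ (smul_mem_orthant he ht)).ne'
    rw [norm_smul_diagDir hd ht, norm_smul, Real.norm_of_nonneg ht.le,
      Real.mul_rpow ht.le hn.le]
    field_simp
  · exact iff_of_false (hLpos x hx).ne' (hφpos _ (dir_mem_spherePart hd hx).1).ne'
  · rw [mul_div_cancel₀ _ (Real.rpow_pos_of_pos (norm_pos_of_mem_orthant hd hx) ρ).ne']

/-! ### Representation of radially slowly varying functions -/

/-- A radially slowly varying function factors into its values along the diagonal, its limit
function and a factor that tends to `1` along every ray. -/
theorem IsRadiallySlowlyVarying.exists_representation (hd : 1 ≤ d)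
    {L : EuclideanSpace ℝ (Fin d) → ℝ} (h : IsRadiallySlowlyVarying L) :
    ∃ (K : EuclideanSpace ℝ (Fin d) → ℝ) (l : ℝ → ℝ) (lam : EuclideanSpace ℝ (Fin d) → ℝ),
      HasExpIntegralRep K ∧ IsSlowlyVarying l ∧ (∀ a ∈ spherePart d, 0 ≤ lam a) ∧
      0 < lam (diagDir d) ∧ ∀ x ∈ orthant d, L x = K x * l ‖x‖ * lam (dir x) := by
  obtain ⟨hL, hL0, lam, ⟨hlam0, hlame, hlim⟩, hzero⟩ := h
  have he := diagDir_mem_orthant hd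
  have hlpos : ∀ t : ℝ, 0 < t → 0 < L (t • diagDir d) := fun t ht => by
    have hte := smul_mem_orthant he ht
    refine (hL0 _ hte).lt_of_ne' fun h0 => ?_
    rw [hzero _ hte, dir_smul _ ht, dir_diagDir hd, hlame] at h0
    exact one_ne_zero h0
  let q : EuclideanSpace ℝ (Fin d) → ℝ := fun x => L x / L (‖x‖ • diagDir d) / lam (dir x)
  let η : EuclideanSpace ℝ (Fin d) → ℝ := fun x => Real.log (q x)
  refine ⟨fun x => Real.exp (η x), fun t => L (t • diagDir d), lam,
    ⟨1, 0, η, fun _ => 0, one_pos, fun x hx => ?_, fun k _ => isLittleO_zero _ _, fun b _ => ?_,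
      fun x _ => by simp⟩,
    ⟨measurable_comp_smul hL he, hlpos, fun c hc => ?_⟩, hlam0, by rw [hlame]; exact one_pos,
    fun x hx => ?_⟩
  · have hn := norm_pos_of_mem_orthant hd hx
    by_cases h0 : lam (dir x) = 0
    -- Here `q` is a division by zero, so `q = 0` and `Real.log 0 = 0` give `η = 0` on the whole
    -- ray, matching `C = 0`.
    · refine tendsto_const_nhds.congr' ?_
      filter_upwards [eventually_gt_atTop 0] with t ht
      simp [η, q, dir_smul x ht, h0]
    · have h₁ : Tendsto (fun t : ℝ => L ((t * ‖x‖) • dir x) / L ((t * ‖x‖) • diagDir d)) atTop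
          (𝓝 (lam (dir (dir x)))) :=
        (hlim _ (dir_mem_spherePart hd hx).1).comp (tendsto_id.atTop_mul_const hn)
      have hdd : dir (dir x) = dir x := dir_smul x (inv_pos.2 hn)
      rw [hdd] at h₁
      have h₂ := h₁.div_const (lam (dir x))
      rw [div_self h0] at h₂
      have h₃ := h₂.log one_ne_zero
      rw [Real.log_one] at h₃
      refine h₃.congr' ?_
      filter_upwards [eventually_gt_atTop 0] with t ht
      simp only [η, q]
      rw [dir_smul x ht, norm_smul, Real.norm_of_nonneg ht.le, mul_smul t ‖x‖ (dir x),
        norm_smul_dir hd hx]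
  · simp
  -- Points `c • e` have direction `e`, where the limit is `1`: this is slow variation of `l`.
  · have h := hlim _ (smul_mem_orthant he hc)
    rw [dir_smul _ hc, dir_diagDir hd, hlame] at h
    simpa only [smul_smul, mul_comm] using h
  · have hl := hlpos _ (norm_pos_of_mem_orthant hd hx)
    by_cases h0 : lam (dir x) = 0
    · rw [h0, mul_zero, hzero x hx, h0]
    · have hLx : 0 < L x := (hL0 x hx).lt_of_ne' fun h => h0 ((hzero x hx).1 h)
      have hlx : 0 < lam (dir x) := (hlam0 _ (dir_mem_spherePart hd hx)).lt_of_ne' h0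
      have hq : 0 < q x := div_pos (div_pos hLx hl) hlx
      simp only [η]
      rw [Real.exp_log hq]
      simp only [q]
      field_simp

/-! ### The converse -/

/-- If `ε` tends to `0` at infinity, so do the integrals of `ε(u)/u` over `[t, tc]`. -/
lemma tendsto_integral_div_of_tendsto_zero {ε : ℝ → ℝ} (hε : Tendsto ε atTop (𝓝 0)) {c : ℝ}
    (hc : 0 < c) : Tendsto (fun t : ℝ => ∫ u in t..t * c, ε u / u) atTop (𝓝 0) := by
  rw [Metric.tendsto_nhds]
  intro δ hδ
  have hm : 0 < min 1 c := lt_min one_pos hc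
  -- The range of integration has length `t * |c - 1|` and lies above `t * min 1 c`, so `|ε| < κ`
  -- there bounds the integral independently of `t`.
  obtain ⟨κ, hκ, hκδ⟩ : ∃ κ : ℝ, 0 < κ ∧ κ / min 1 c * |c - 1| < δ := by
    refine ⟨δ * min 1 c / (|c - 1| + 1), by positivity, ?_⟩
    have : δ * min 1 c / (|c - 1| + 1) / min 1 c * |c - 1| = δ * (|c - 1| / (|c - 1| + 1)) := by
      field_simp
    rw [this]
    have h1 : |c - 1| / (|c - 1| + 1) < 1 := (div_lt_one (by positivity)).2 (by linarith)
    nlinarith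
  obtain ⟨N, hN⟩ := eventually_atTop.1 ((Metric.tendsto_nhds.1 hε) κ hκ)
  filter_upwards [eventually_gt_atTop 0, eventually_ge_atTop (N / min 1 c)] with t ht htN
  rw [div_le_iff₀ hm] at htN
  rw [dist_zero_right]
  have hb : ∀ u ∈ Set.uIoc t (t * c), ‖ε u / u‖ ≤ κ / (t * min 1 c) := fun u hu => by
    have hu' : t * min 1 c ≤ u := by
      rw [mul_min_of_nonneg _ _ ht.le, mul_one]
      exact hu.1.le
    have hκu : ‖ε u‖ < κ := by simpa using hN u (htN.trans hu')
    have htm : 0 < t * min 1 c := mul_pos ht hm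
    rw [norm_div, Real.norm_of_nonneg (htm.le.trans hu')]
    gcongr
  refine (intervalIntegral.norm_integral_le_of_norm_le_const hb).trans_lt ?_
  have : t * c - t = t * (c - 1) := by ring
  rw [this, abs_mul, abs_of_pos ht]
  calc κ / (t * min 1 c) * (t * |c - 1|) = κ / min 1 c * |c - 1| := by field_simp
    _ < δ := hκδ

/-- A function with an exponential integral representation is positive, and its values on any ray
are asymptotically equal to those on the diagonal. -/
lemma HasExpIntegralRep.tendsto_div (hd : 1 ≤ d) {K : EuclideanSpace ℝ (Fin d) → ℝ}
    (hK : HasExpIntegralRep K) :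
    (∀ x ∈ orthant d, 0 < K x) ∧ ∀ x ∈ orthant d,
      Tendsto (fun t : ℝ => K (t • x) / K (t • diagDir d)) atTop (𝓝 1) := by
  obtain ⟨a, C, η, ε, ha, hη, hε, hint, hK⟩ := hK
  refine ⟨fun x hx => by rw [hK x hx]; exact Real.exp_pos _, fun x hx => ?_⟩
  have he := diagDir_mem_orthant hd
  have hn := norm_pos_of_mem_orthant hd hx
  have hε0 : Tendsto ε atTop (𝓝 0) := by
    have h := hε 0 le_rfl
    simp only [neg_zero, Real.rpow_zero] at h
    exact (isLittleO_one_iff ℝ).1 h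
  have h := (((hη x hx).sub (hη _ he)).add (tendsto_integral_div_of_tendsto_zero hε0 hn)).rexp
  rw [sub_self, add_zero, Real.exp_zero] at h
  refine h.congr' ?_
  filter_upwards [eventually_gt_atTop 0] with t ht
  rw [hK _ (smul_mem_orthant hx ht), hK _ (smul_mem_orthant he ht), ← Real.exp_sub,
    norm_smul_diagDir hd ht, norm_smul, Real.norm_of_nonneg ht.le,
    ← intervalIntegral.integral_interval_sub_left (hint _ (mul_pos ht hn)) (hint t ht)]
  congr 1
  ring

/-- Products `K(x) l(‖x‖) λ(x/‖x‖)` are radially slowly varying. -/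
theorem isRadiallySlowlyVarying_of_representation (hd : 1 ≤ d)
    {L : EuclideanSpace ℝ (Fin d) → ℝ} (hL : Measurable ((orthant d).domRestrict L))
    {K : EuclideanSpace ℝ (Fin d) → ℝ} {l : ℝ → ℝ} {lam : EuclideanSpace ℝ (Fin d) → ℝ}
    (hK : HasExpIntegralRep K) (hl : IsSlowlyVarying l) (hlam : ∀ a ∈ spherePart d, 0 ≤ lam a)
    (hlame : 0 < lam (diagDir d)) (hrep : ∀ x ∈ orthant d, L x = K x * l ‖x‖ * lam (dir x)) :
    IsRadiallySlowlyVarying L := by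
  obtain ⟨hKpos, hKlim⟩ := hK.tendsto_div hd
  obtain ⟨-, hlpos, hllim⟩ := hl
  have he := diagDir_mem_orthant hd
  -- Only `0 < lam e` is given, so the limit function is `lam` normalized at `e`.
  refine ⟨hL, fun x hx => ?_, fun a => lam a / lam (diagDir d),
    ⟨fun a ha => div_nonneg (hlam a ha) hlame.le, div_self hlame.ne', fun x hx => ?_⟩,
    fun x hx => ?_⟩
  · rw [hrep x hx]
    exact mul_nonneg (mul_pos (hKpos x hx) (hlpos _ (norm_pos_of_mem_orthant hd hx))).le
      (hlam _ (dir_mem_spherePart hd hx))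
  · have hn := norm_pos_of_mem_orthant hd hx
    have h := ((hKlim x hx).mul (hllim _ hn)).mul_const (lam (dir x) / lam (diagDir d))
    rw [one_mul, one_mul] at h
    refine h.congr' ?_
    filter_upwards [eventually_gt_atTop 0] with t ht
    rw [hrep _ (smul_mem_orthant hx ht), hrep _ (smul_mem_orthant he ht), dir_smul x ht,
      dir_smul _ ht, dir_diagDir hd, norm_smul_diagDir hd ht, norm_smul,
      Real.norm_of_nonneg ht.le, mul_comm ‖x‖ t, mul_div_mul_comm, mul_div_mul_comm]
  · have h1 := (hKpos x hx).ne'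
    have h2 := (hlpos _ (norm_pos_of_mem_orthant hd hx)).ne'
    rw [hrep x hx]
    simp [h1, h2, hlame.ne']

end RadialVariation

theorem mainTheorem8 (d : ℕ) (hd : 1 ≤ d) :
    (∀ f : EuclideanSpace ℝ (Fin d) → ℝ, RadialVariation.IsRadiallyRegularlyVarying f →
      ∃ (ρ : ℝ) (L : EuclideanSpace ℝ (Fin d) → ℝ),
        RadialVariation.IsRadiallySlowlyVarying L ∧
        ∀ x ∈ RadialVariation.orthant d, f x = ‖x‖ ^ ρ * L x) ∧
    (∀ L : EuclideanSpace ℝ (Fin d) → ℝ,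
      Measurable ((RadialVariation.orthant d).domRestrict L) →
      (RadialVariation.IsRadiallySlowlyVarying L ↔
        ∃ (K : EuclideanSpace ℝ (Fin d) → ℝ) (l : ℝ → ℝ) (lam : EuclideanSpace ℝ (Fin d) → ℝ),
          RadialVariation.HasExpIntegralRep K ∧
          RadialVariation.IsSlowlyVarying l ∧
          (∀ a ∈ RadialVariation.spherePart d, 0 ≤ lam a) ∧
          0 < lam (RadialVariation.diagDir d) ∧
          ∀ x ∈ RadialVariation.orthant d,
            L x = K x * l ‖x‖ * lam (RadialVariation.dir x))) := by
  refine ⟨fun f hf => hf.exists_rpow_mul hd, fun L hL => ⟨fun h => h.exists_representation hd, ?_⟩⟩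
  rintro ⟨K, l, lam, hK, hl, hlam, hlame, hrep⟩
  exact RadialVariation.isRadiallySlowlyVarying_of_representation hd hL hK hl hlam hlame hrep
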